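/- **Setting.** A *metric group* is a topological group $G$ with a left-invariant distance $d$ inducing its topology; for $A\subset G$ put $d(x,A)=\inf_{a\in A}d(x,a)$. Let $G=N\rtimes H$ be a metric group that is a semidirect product, i.e. $N$ and $H$ are closed subgroups of $G$, $N$ is normal, and every $g\in G$ can be written uniquely as $g=\pi_N(g)\,\pi_H(g)$ with $\pi_N(g)\in N$ and $\pi_H(g)\in H$. Subgroups carry the restricted distance. Let $\pi:G\to G/H$, $g\mapsto gH$. A map $\phi:G/H\to G$ is an *intrinsically Lipschitz section* of $\pi$ if $\pi\circ\phi=\mathrm{id}$ and there is $L\ge 1$ such that $$d(\phi(y_1),\phi(y_2))\le L\,d(\phi(y_1),\pi^{-1}(y_2))\qquad\text{for all } y_1,y_2\in G/H;$$ its image is then called an *intrinsically Lipschitz graph*. For $\psi:N\to H$ let $\Gamma_\psi=\{n\psi(n):n\in N\}$; $\psi$ is *intrinsically Lipschitz in the FSSC sense* if there is $K>0$ with $d(1_G,\pi_H(x^{-1}x'))\le K\,d(1_G,\pi_N(x^{-1}x'))$ for all $x,x'\in\Gamma_\psi$. The map $\pi_N$ is *Lipschitz at $1_G$* if there is $K$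 with $d(1_G,\pi_N(g))\le K\,d(1_G,g)$ for all $g\in G$. A *Carnot group* is a simply connected Lie group $G$ whose Lie algebra has a stratification $\mathfrak g=V_1\oplus\dots\oplus V_s$, $[V_1,V_j]=V_{j+1}$ for $1\le j\le s$ (with $V_{s+1}=0$), equipped with a left-invariant distance that induces the topology and is homogeneous, i.e. $d(\delta_t x,\delta_t y)=t\,d(x,y)$ for all $t>0$ (for instance, a Carnot–Carathéodory distance associated with $V_1$); here $\delta_t:G\to G$ is the Lie group automorphism whose differential at $1_G$ is multiplication by $t^j$ on $V_j$. A subgroup is *homogeneous* if it is invariant under $\delta_t$ for every $t>0$. **Proposition.** Let $G=N\rtimes H$ be a metric group that is a semidirect product. (i) If $G$ is a Carnot group and $N$, $H$ are homogeneous subgroups, then (i.a) $\pi_H:G\to H$ is a Lipschitz homomorphism, and (i.b) $\pi_N:G\to N$ is Lipschitz at $1_G$. In general (for any metric group $G=N\rtimes H$), if (i.a) or (i.b) holds, then the following three properties hold: (ii) for every $g\in G$ the set $gN$ is an intrinsically Lipschitz graph; (iii) if $\psi:N\to H$ is intrinsically Lipschitz in the FSSC sense, then $$\phi(gH):=\pi_N(g)\,\psi(\pi_N(g)),\qquad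 g\in G,$$ is a well-defined map $\phi:G/H\to G$, it is an intrinsically Lipschitz section of $\pi$, and $\phi(G/H)=\Gamma_\psi$; (iv) conversely, if $\phi:G/H\to G$ is an intrinsically Lipschitz section of $\pi$, then $\psi(n):=n^{-1}\phi(nH)$, $n\in N$, takes values in $H$, the map $\psi:N\to H$ is intrinsically Lipschitz in the FSSC sense, and $\phi(G/H)=\Gamma_\psi$. -/

import Mathlib

open scoped Manifold ContDiff

noncomputable section

/-! ### Intrinsically Lipschitz sections of a map from a metric space -/

/-- `φ` is an intrinsically Lipschitz section of `π` with constant `L ≥ 1`: it is a section, and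
`d(φ(y₁), φ(y₂)) ≤ L d(φ(y₁), π⁻¹(y₂))` for all `y₁, y₂`. (The fibres are non-empty since `φ` is a
section, so `Metric.infDist` is the usual distance to a set.) -/
structure IsIntrinsicLipschitzSectionWith {X Y : Type*} [MetricSpace X]
    (L : ℝ) (π : X → Y) (φ : Y → X) : Prop where
  one_le : 1 ≤ L
  comp_eq_id : π ∘ φ = id
  dist_le : ∀ y₁ y₂ : Y, dist (φ y₁) (φ y₂) ≤ L * Metric.infDist (φ y₁) (π ⁻¹' {y₂})

/-- `φ` is an intrinsically Lipschitz section of `π` for some constant. -/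
def IsIntrinsicLipschitzSection {X Y : Type*} [MetricSpace X] (π : X → Y) (φ : Y → X) : Prop :=
  ∃ L : ℝ, IsIntrinsicLipschitzSectionWith L π φ

/-- A subset of `X` is an intrinsically Lipschitz graph (with respect to `π`) if it is the image of
an intrinsically Lipschitz section of `π`. -/
def IsIntrinsicLipschitzGraph {X Y : Type*} [MetricSpace X] (π : X → Y) (S : Set X) : Prop :=
  ∃ φ : Y → X, IsIntrinsicLipschitzSection π φ ∧ Set.range φ = S

/-! ### Splittings of a metric group -/

/-- The splitting `G = H₁ · H₂`: the subgroups are closed and every element of `G` is uniquely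
of the form `h₁ h₂` with `h₁ ∈ H₁` and `h₂ ∈ H₂`. -/
structure IsSplitting {G : Type*} [Group G] [TopologicalSpace G] (H₁ H₂ : Subgroup G) : Prop where
  isClosed_left : IsClosed (H₁ : Set G)
  isClosed_right : IsClosed (H₂ : Set G)
  isComplement : Subgroup.IsComplement' H₁ H₂

namespace IsSplitting

variable {G : Type*} [Group G] [TopologicalSpace G] {H₁ H₂ : Subgroup G}

/-- The projection `π_{H₁} : G → H₁`, `h₁ h₂ ↦ h₁`. -/
def projLeft (h : IsSplitting H₁ H₂) (g : G) : H₁ :=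
  (Subgroup.IsComplement.equiv h.isComplement g).1

/-- The projection `π_{H₂} : G → H₂`, `h₁ h₂ ↦ h₂`. -/
def projRight (h : IsSplitting H₁ H₂) (g : G) : H₂ :=
  (Subgroup.IsComplement.equiv h.isComplement g).2

theorem projLeft_mul_projRight (h : IsSplitting H₁ H₂) (g : G) :
    (h.projLeft g : G) * h.projRight g = g :=
  Subgroup.IsComplement.equiv_fst_mul_equiv_snd h.isComplement g

end IsSplitting

/-- The graph `Γ_ψ = {n ψ(n) : n ∈ H₁}` of a map `ψ : H₁ → H₂`. -/
def groupGraph {G : Type*} [Group G] {H₁ H₂ : Subgroup G} (ψ : H₁ → H₂) : Set G :=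
  Set.range fun n : H₁ => (n : G) * (ψ n : G)

/-- `ψ : H₁ → H₂` is intrinsically Lipschitz in the sense of Franchi, Serapioni and Serra
Cassano. -/
def IsFSSCLipschitz {G : Type*} [Group G] [MetricSpace G] {H₁ H₂ : Subgroup G}
    (h : IsSplitting H₁ H₂) (ψ : H₁ → H₂) : Prop :=
  ∃ K : ℝ, 0 < K ∧ ∀ x ∈ groupGraph ψ, ∀ x' ∈ groupGraph ψ,
    dist (1 : G) (h.projRight (x⁻¹ * x')) ≤ K * dist (1 : G) (h.projLeft (x⁻¹ * x'))

/-- `f` is a group homomorphism and a Lipschitz map. -/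
def IsLipschitzHom {G G' : Type*} [Group G] [MetricSpace G] [Group G'] [MetricSpace G']
    (f : G → G') : Prop :=
  (∀ a b : G, f (a * b) = f a * f b) ∧ ∃ K : NNReal, LipschitzWith K f

/-- A map `f` from `G` to a subgroup is Lipschitz at the identity:
`d(1, f(g)) ≤ K d(1, g)` for all `g`. -/
def IsLipschitzAtOne {G : Type*} [Group G] [MetricSpace G] {H₁ : Subgroup G}
    (f : G → H₁) : Prop :=
  ∃ K : ℝ, ∀ g : G, dist (1 : G) (f g) ≤ K * dist (1 : G) g

/-! ### Carnot groups -/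

/-- A stratification `𝔤 = V₁ ⊕ ⋯ ⊕ V_s` of the Lie algebra `𝔤` (left-invariant vector fields,
identified with the tangent space at `1`) of an `n`-dimensional Lie group `G`:
`[V₁, V_j] = V_{j+1}` for `j ≥ 1`, where `V_j = 0` for `j > s`. The index `0` is not
used: `V₀ = 0`. -/
structure Stratification (n : ℕ) (G : Type*) [TopologicalSpace G]
    [ChartedSpace (EuclideanSpace ℝ (Fin n)) G] [Group G] where
  layer : ℕ → Submodule ℝ (GroupLieAlgebra (𝓡 n) G)
  step : ℕ
  layer_zero : layer 0 = ⊥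
  layer_eq_bot : ∀ j, step < j → layer j = ⊥
  isInternal : DirectSum.IsInternal layer
  bracket_eq : ∀ j, 1 ≤ j →
    Submodule.span ℝ {z | ∃ x ∈ layer 1, ∃ y ∈ layer j, ⁅x, y⁆ = z} = layer (j + 1)

namespace Stratification

variable {n : ℕ} {G : Type*} [TopologicalSpace G]
  [ChartedSpace (EuclideanSpace ℝ (Fin n)) G] [Group G]

/-- `δ` is a Lie group endomorphism whose differential at the identity is the Lie algebra dilation
of factor `t`, i.e. multiplication by `t ^ j` on the layer `V_j`. -/
def IsDilation (S : Stratification n G) (t : ℝ) (δ : G →* G) : Prop :=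
  ContMDiff (𝓡 n) (𝓡 n) ∞ δ ∧
    ∀ j, ∀ v ∈ S.layer j,
      (mfderiv (𝓡 n) (𝓡 n) δ (1 : G) v : EuclideanSpace ℝ (Fin n)) =
        t ^ j • (v : EuclideanSpace ℝ (Fin n))

open Classical in
/-- The intrinsic dilation `δ_t` of a stratified group. If `G` is a simply connected Lie group and
`t > 0`, there is exactly one `δ` with `S.IsDilation t δ`, so the second branch does not occur. -/
def dilation (S : Stratification n G) (t : ℝ) : G →* G :=
  if h : ∃ δ : G →* G, S.IsDilation t δ then h.choose else MonoidHom.id G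

/-- A subgroup is homogeneous if it is invariant under the intrinsic dilations. -/
def IsHomogeneousSubgroup (S : Stratification n G) (N : Subgroup G) : Prop :=
  ∀ t : ℝ, 0 < t → ∀ x ∈ N, S.dilation t x ∈ N

end Stratification

/-- A left-invariant distance on a stratified group is a Carnot group distance if it is homogeneous
of degree one with respect to the intrinsic dilations. Carnot–Carathéodory distances,
sub-Riemannian or sub-Finsler, are of this kind. -/
def Stratification.IsHomogeneousDist {n : ℕ} {G : Type*} [MetricSpace G]
    [ChartedSpace (EuclideanSpace ℝ (Fin n)) G] [Group G] (S : Stratification n G) : Prop :=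
  ∀ t : ℝ, 0 < t → ∀ x y : G, dist (S.dilation t x) (S.dilation t y) = t * dist x y

end

/-!
Everything rests on comparing `d(1, g)` with `d(1, π_N(g))` and `d(1, π_H(g))`.

For a Carnot group, the dilations are homomorphisms preserving `N` and `H` which rescale distances.
Small closed balls are compact because `G` is locally Euclidean, so on the compact set of pairs
`(a, b) ∈ N × H` with `max (d(1, a)) (d(1, b)) = r` the continuous function `d(1, a b)`, which does
not vanish as `N ∩ H = 1`, is bounded below by a positive constant. Rescaling turns this into
`max (d(1, π_N(g))) (d(1, π_H(g))) ≤ K d(1, g)` for all `g`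
(`IsSplitting.exists_max_dist_le_mul_dist`). Since `π_H` is a homomorphism (`N` is normal) and `d`
is left-invariant, the bound on `π_H` upgrades to the Lipschitz property.

In a general metric group, the two hypotheses are the same estimate, because
`d(1, n) ≤ d(1, n h) + d(1, h)`. Left-invariance moves each inequality about sections to the
identity: with `x, x'` in the graph, the fibre through `x'` is `x' H`, and `π_N(x⁻¹ x' h)` does not
depend on `h ∈ H`. So Lipschitz continuity of `π_N` at `1` bounds `d(1, π_N(x⁻¹ x'))` by the distance
of `x` to the fibre, while the point `x' π_H(x⁻¹ x')⁻¹ = x π_N(x⁻¹ x')` of the fibre shows the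
opposite bound. The sets `g N` are left translates of the graph of `ψ = 1`.
-/

/-! ### Algebra of the projections of a splitting -/

namespace IsSplitting

variable {G : Type*} [Group G] [TopologicalSpace G] {N H : Subgroup G}

theorem proj_eq_of_mul_eq (h : IsSplitting N H) {g : G} (a : N) (b : H) (hab : (a : G) * b = g) :
    h.projLeft g = a ∧ h.projRight g = b := by
  have key : (h.projLeft g, h.projRight g) = (a, b) :=
    h.isComplement.1 ((h.projLeft_mul_projRight g).trans hab.symm)
  exact Prod.mk.inj key

theorem projLeft_coe (h : IsSplitting N H) (a : N) : h.projLeft (a : G) = a :=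
  (h.proj_eq_of_mul_eq a 1 (by simp)).1

theorem projRight_coe (h : IsSplitting N H) (a : N) : h.projRight (a : G) = 1 :=
  (h.proj_eq_of_mul_eq a 1 (by simp)).2

theorem projLeft_mul_right (h : IsSplitting N H) (g : G) (b : H) :
    h.projLeft (g * b) = h.projLeft g :=
  (h.proj_eq_of_mul_eq (h.projLeft g) (h.projRight g * b) (by
    rw [Subgroup.coe_mul, ← mul_assoc, h.projLeft_mul_projRight])).1

theorem projLeft_eq_of_mk_eq (h : IsSplitting N H) {x y : G}
    (hxy : (QuotientGroup.mk x : G ⧸ H) = QuotientGroup.mk y) :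
    h.projLeft x = h.projLeft y := by
  have hm : x⁻¹ * y ∈ H := QuotientGroup.eq.1 hxy
  simpa using (h.projLeft_mul_right x ⟨_, hm⟩).symm

theorem mk_projLeft (h : IsSplitting N H) (g : G) :
    (QuotientGroup.mk (h.projLeft g : G) : G ⧸ H) = QuotientGroup.mk g := by
  refine QuotientGroup.eq.2 ?_
  have hg := h.projLeft_mul_projRight g
  rw [← eq_inv_mul_iff_mul_eq] at hg
  exact hg ▸ (h.projRight g).2

theorem projRight_mul (h : IsSplitting N H) (hN : N.Normal) (x y : G) :
    h.projRight (x * y) = h.projRight x * h.projRight y := by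
  refine (h.proj_eq_of_mul_eq
    (h.projLeft x * ⟨_, hN.conj_mem _ (h.projLeft y).2 (h.projRight x)⟩)
    (h.projRight x * h.projRight y) ?_).2
  conv_rhs => rw [← h.projLeft_mul_projRight x, ← h.projLeft_mul_projRight y]
  simp only [Subgroup.coe_mul]
  group

end IsSplitting

/-! ### Distances in a metric group with a splitting -/

section LeftInvariant

variable {G : Type*} [Group G] [MetricSpace G]

theorem dist_one_inv_mul_of_left_invariant (hleft : ∀ a x y : G, dist (a * x) (a * y) = dist x y)
    (x y : G) : dist 1 (x⁻¹ * y) = dist x y := by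
  simpa using hleft x⁻¹ x y

theorem dist_one_mul_le_of_left_invariant (hleft : ∀ a x y : G, dist (a * x) (a * y) = dist x y)
    (x y : G) : dist 1 (x * y) ≤ dist 1 x + dist 1 y := by
  have h := hleft x 1 y
  rw [mul_one] at h
  exact h ▸ dist_triangle 1 x (x * y)

theorem dist_one_inv_of_left_invariant (hleft : ∀ a x y : G, dist (a * x) (a * y) = dist x y)
    (x : G) : dist 1 x⁻¹ = dist 1 x := by
  simpa [dist_comm] using (hleft x 1 x⁻¹).symm

variable {N H : Subgroup G}

theorem IsSplitting.isLipschitzHom_projRight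
    (hleft : ∀ a x y : G, dist (a * x) (a * y) = dist x y)
    (h : IsSplitting N H) (hN : N.Normal) {K : ℝ} (hK : 0 ≤ K)
    (hR : ∀ g : G, dist (1 : G) (h.projRight g) ≤ K * dist (1 : G) g) :
    IsLipschitzHom h.projRight := by
  refine ⟨h.projRight_mul hN, K.toNNReal, LipschitzWith.of_dist_le_mul fun x y => ?_⟩
  have hxy : h.projRight y = h.projRight x * h.projRight (x⁻¹ * y) := by
    rw [← h.projRight_mul hN, mul_inv_cancel_left]
  have hquot : ((h.projRight x : G))⁻¹ * h.projRight y = h.projRight (x⁻¹ * y) := by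
    rw [hxy, Subgroup.coe_mul, inv_mul_cancel_left]
  rw [Real.coe_toNNReal K hK, Subtype.dist_eq, ← dist_one_inv_mul_of_left_invariant hleft, hquot,
    ← dist_one_inv_mul_of_left_invariant hleft x y]
  exact hR _

/-- Either hypothesis bounds the `N`-component, as `d(1, n) ≤ d(1, n h) + d(1, h)`. -/
theorem IsSplitting.isLipschitzAtOne_projLeft
    (hleft : ∀ a x y : G, dist (a * x) (a * y) = dist x y) (h : IsSplitting N H)
    (hRL : IsLipschitzHom h.projRight ∨ IsLipschitzAtOne h.projLeft) :
    IsLipschitzAtOne h.projLeft := by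
  rcases hRL with ⟨-, K, hK⟩ | hL
  · refine ⟨1 + K, fun g => ?_⟩
    have hR : dist (1 : G) (h.projRight g) ≤ K * dist 1 g := by
      have := hK.dist_le_mul 1 g
      rwa [show h.projRight 1 = 1 from h.projRight_coe 1, Subtype.dist_eq] at this
    have hg : (h.projLeft g : G) = g * (h.projRight g : G)⁻¹ :=
      eq_mul_inv_of_mul_eq (h.projLeft_mul_projRight g)
    have := dist_one_mul_le_of_left_invariant hleft g (h.projRight g : G)⁻¹
    rw [dist_one_inv_of_left_invariant hleft, ← hg] at this
    linarith
  · exact hL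

/-! ### Intrinsically Lipschitz sections and graphs -/

/-- The distance to a fibre may be tested on the points `p` of the fibre, and the constant need not
be at least `1`. -/
theorem isIntrinsicLipschitzSection_of_dist_le {X Y : Type*} [MetricSpace X] {π : X → Y}
    {φ : Y → X} (hφ : π ∘ φ = id) (L : ℝ)
    (hL : ∀ (y : Y) (p : X), dist (φ y) (φ (π p)) ≤ L * dist (φ y) p) :
    IsIntrinsicLipschitzSection π φ := by
  refine ⟨max 1 L, le_max_left _ _, hφ, fun y₁ y₂ => ?_⟩
  have hpos : (0 : ℝ) < max 1 L := lt_of_lt_of_le one_pos (le_max_left _ _)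
  rw [← div_le_iff₀' hpos]
  refine (Metric.le_infDist ⟨φ y₂, congrFun hφ y₂⟩).2 fun p hp => ?_
  have hp' : π p = y₂ := hp
  rw [div_le_iff₀' hpos, ← hp']
  exact (hL y₁ p).trans (mul_le_mul_of_nonneg_right (le_max_right _ _) dist_nonneg)

theorem IsIntrinsicLipschitzSectionWith.dist_le_dist {X Y : Type*} [MetricSpace X] {π : X → Y}
    {φ : Y → X} {L : ℝ} (hφ : IsIntrinsicLipschitzSectionWith L π φ) (y : Y) (p : X) :
    dist (φ y) (φ (π p)) ≤ L * dist (φ y) p :=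
  (hφ.dist_le y (π p)).trans (mul_le_mul_of_nonneg_left (Metric.infDist_le_dist_of_mem rfl)
    (zero_le_one.trans hφ.one_le))

theorem IsIntrinsicLipschitzGraph.mul_left_image
    (hleft : ∀ a x y : G, dist (a * x) (a * y) = dist x y) {S : Set G}
    (hS : IsIntrinsicLipschitzGraph (QuotientGroup.mk : G → G ⧸ H) S) (g : G) :
    IsIntrinsicLipschitzGraph (QuotientGroup.mk : G → G ⧸ H) ((fun x : G => g * x) '' S) := by
  obtain ⟨φ, ⟨L, hφ⟩, rfl⟩ := hS
  refine ⟨fun y => g * φ (g⁻¹ • y),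
    isIntrinsicLipschitzSection_of_dist_le (funext fun y => ?_) L fun y p => ?_, ?_⟩
  · have : (QuotientGroup.mk (φ (g⁻¹ • y)) : G ⧸ H) = g⁻¹ • y := congrFun hφ.comp_eq_id _
    change g • (QuotientGroup.mk (φ (g⁻¹ • y)) : G ⧸ H) = y
    rw [this, smul_inv_smul]
  · have := hφ.dist_le_dist (g⁻¹ • y) (g⁻¹ * p)
    rw [← hleft g _ (g⁻¹ * p), mul_inv_cancel_left] at this
    rw [hleft]
    exact this
  · rw [← Set.range_comp]
    exact (MulAction.surjective (g⁻¹ : G)).range_comp (fun y : G ⧸ H => g * φ y)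

theorem IsFSSCLipschitz.exists_section
    (hleft : ∀ a x y : G, dist (a * x) (a * y) = dist x y) {h : IsSplitting N H}
    (hL : IsLipschitzAtOne h.projLeft) {ψ : N → H} (hψ : IsFSSCLipschitz h ψ) :
    ∃ φ : G ⧸ H → G,
      (∀ g : G, φ (QuotientGroup.mk g) = (h.projLeft g : G) * (ψ (h.projLeft g) : G)) ∧
      IsIntrinsicLipschitzSection (QuotientGroup.mk : G → G ⧸ H) φ ∧
      Set.range φ = groupGraph ψ := by
  obtain ⟨K, hK, hKψ⟩ := hψ
  obtain ⟨C, hC⟩ := hL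
  set f : G → G := fun g => (h.projLeft g : G) * (ψ (h.projLeft g) : G) with hf
  have hfmk : ∀ g, (QuotientGroup.mk (f g) : G ⧸ H) = QuotientGroup.mk g := fun g => by
    rw [← h.mk_projLeft g]
    exact QuotientGroup.mk_mul_of_mem _ (ψ _).2
  let φ : G ⧸ H → G := fun y => f y.out
  have hφ : ∀ g : G, φ (QuotientGroup.mk g) = f g := fun g => by
    have : h.projLeft (QuotientGroup.mk g : G ⧸ H).out = h.projLeft g :=
      h.projLeft_eq_of_mk_eq (QuotientGroup.out_eq' _)
    simp only [φ, hf, this]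
  have hrange : ∀ g, f g ∈ groupGraph ψ := fun g => ⟨h.projLeft g, rfl⟩
  refine ⟨φ, hφ, isIntrinsicLipschitzSection_of_dist_le (funext fun y => ?_) ((1 + K) * C)
    fun y p => ?_, ?_⟩
  · exact (hfmk _).trans (QuotientGroup.out_eq' y)
  · rw [hφ]
    set x := φ y
    have hx : x ∈ groupGraph ψ := hrange _
    set z := x⁻¹ * f p
    -- `f p` and `p` lie in the same coset of `H`, hence so do `x⁻¹ * f p` and `x⁻¹ * p`.
    have hproj : h.projLeft z = h.projLeft (x⁻¹ * p) :=
      h.projLeft_eq_of_mk_eq (congrArg (x⁻¹ • ·) (hfmk p))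
    have h₁ : dist 1 z ≤ dist (1 : G) (h.projLeft z) + dist (1 : G) (h.projRight z) := by
      conv_lhs => rw [← h.projLeft_mul_projRight z]
      exact dist_one_mul_le_of_left_invariant hleft _ _
    have h₂ := hKψ x hx (f p) (hrange p)
    have h₃ := hC (x⁻¹ * p)
    rw [← hproj, dist_one_inv_mul_of_left_invariant hleft] at h₃
    calc dist x (f p) = dist 1 z := (dist_one_inv_mul_of_left_invariant hleft _ _).symm
      _ ≤ (1 + K) * dist (1 : G) (h.projLeft z) := by linarith
      _ ≤ (1 + K) * (C * dist x p) := mul_le_mul_of_nonneg_left h₃ (by linarith)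
      _ = (1 + K) * C * dist x p := by ring
  · refine Set.Subset.antisymm (Set.range_subset_iff.2 fun y => hrange _) ?_
    rintro _ ⟨a, rfl⟩
    refine ⟨QuotientGroup.mk (a : G), ?_⟩
    rw [hφ, hf]
    simp only [h.projLeft_coe]

theorem isFSSCLipschitz_one (h : IsSplitting N H) : IsFSSCLipschitz h (fun _ : N => (1 : H)) := by
  refine ⟨1, one_pos, ?_⟩
  rintro _ ⟨a, rfl⟩ _ ⟨b, rfl⟩
  have hab : ((a : G) * (1 : H))⁻¹ * ((b : G) * (1 : H)) = ((a⁻¹ * b : N) : G) := by simp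
  simp only [hab, h.projRight_coe]
  simp

/-- For `x, x'` in the graph and `z = x⁻¹ x'`, the point `x π_N(z)` lies in the fibre of `x'`, so
`d(1, z) ≤ L d(1, π_N(z))`, and `d(1, π_H(z)) ≤ d(1, π_N(z)) + d(1, z)`. -/
theorem IsIntrinsicLipschitzSection.exists_isFSSCLipschitz
    (hleft : ∀ a x y : G, dist (a * x) (a * y) = dist x y) (h : IsSplitting N H)
    {φ : G ⧸ H → G} (hφ : IsIntrinsicLipschitzSection (QuotientGroup.mk : G → G ⧸ H) φ) :
    ∃ ψ : N → H,
      (∀ n : N, (ψ n : G) = (n : G)⁻¹ * φ (QuotientGroup.mk (n : G))) ∧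
      IsFSSCLipschitz h ψ ∧ Set.range φ = groupGraph ψ := by
  obtain ⟨L, hφ⟩ := hφ
  have hsec : ∀ y, (QuotientGroup.mk (φ y) : G ⧸ H) = y := congrFun hφ.comp_eq_id
  let ψ : N → H := fun n => ⟨(n : G)⁻¹ * φ (QuotientGroup.mk (n : G)),
    QuotientGroup.eq.1 (hsec _).symm⟩
  have hgraph : ∀ n : N, (n : G) * ψ n = φ (QuotientGroup.mk (n : G)) :=
    fun n => mul_inv_cancel_left _ _
  have hrange : Set.range φ = groupGraph ψ := by
    refine Set.Subset.antisymm (Set.range_subset_iff.2 fun y => ?_) ?_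
    · obtain ⟨g, rfl⟩ := QuotientGroup.mk_surjective y
      exact ⟨h.projLeft g, by simp only [hgraph, h.mk_projLeft]⟩
    · rintro _ ⟨n, rfl⟩
      exact ⟨_, (hgraph n).symm⟩
  refine ⟨ψ, fun _ => rfl, ⟨1 + L, by linarith [hφ.one_le], fun x hx x' hx' => ?_⟩, hrange⟩
  rw [← hrange] at hx hx'
  obtain ⟨y, rfl⟩ := hx
  obtain ⟨y', rfl⟩ := hx'
  set z := (φ y)⁻¹ * φ y'
  -- The point of the fibre over `y'` used to bound the distance from `φ y`.
  set p := φ y * h.projLeft z with hp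
  have hpy : (QuotientGroup.mk p : G ⧸ H) = y' := by
    rw [← hsec y', ← mul_inv_cancel_left (φ y) (φ y')]
    exact congrArg (φ y • ·) (h.mk_projLeft z)
  have h₁ := hφ.dist_le_dist y p
  rw [hpy, ← dist_one_inv_mul_of_left_invariant hleft,
    ← dist_one_inv_mul_of_left_invariant hleft (φ y) p, hp, inv_mul_cancel_left] at h₁
  have hright : (h.projRight z : G) = (h.projLeft z : G)⁻¹ * z :=
    eq_inv_mul_of_mul_eq (h.projLeft_mul_projRight z)
  have h₂ := dist_one_mul_le_of_left_invariant hleft (h.projLeft z : G)⁻¹ z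
  rw [← hright, dist_one_inv_of_left_invariant hleft] at h₂
  linarith

/-! ### Groups with homogeneous distances -/

/-- Compactness and scaling: in a locally compact group whose distance is homogeneous for a family
of endomorphisms preserving both factors of a splitting, the factors of `g` are at distance at
most a constant times `d(1, g)` from `1`. The endomorphisms need not form a one-parameter group. -/
theorem IsSplitting.exists_max_dist_le_mul_dist [IsTopologicalGroup G] [LocallyCompactSpace G]
    (h : IsSplitting N H) (δ : ℝ → G →* G)
    (hδ : ∀ t : ℝ, 0 < t → ∀ x y : G, dist (δ t x) (δ t y) = t * dist x y)
    (hδN : ∀ t : ℝ, 0 < t → ∀ x ∈ N, δ t x ∈ N) (hδH : ∀ t : ℝ, 0 < t → ∀ x ∈ H, δ t x ∈ H) :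
    ∃ K : ℝ, 0 ≤ K ∧ ∀ g : G,
      max (dist (1 : G) (h.projLeft g)) (dist (1 : G) (h.projRight g)) ≤ K * dist 1 g := by
  have hδ1 : ∀ t : ℝ, 0 < t → ∀ x : G, dist 1 (δ t x) = t * dist 1 x := fun t ht x => by
    simpa using hδ t ht 1 x
  obtain ⟨r, hr, hcompact⟩ := Metric.exists_isCompact_closedBall (1 : G)
  let S : Set (G × G) := {p | (p.1 ∈ N ∧ p.2 ∈ H) ∧ max (dist 1 p.1) (dist 1 p.2) = r}
  have hSclosed : IsClosed S :=
    ((h.isClosed_left.preimage continuous_fst).inter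
      (h.isClosed_right.preimage continuous_snd)).inter
      (isClosed_eq (by fun_prop) continuous_const)
  have hS : IsCompact S := by
    refine (hcompact.prod hcompact).of_isClosed_subset hSclosed fun p hp => ?_
    have hp2 := hp.2.le
    rw [max_le_iff, dist_comm, dist_comm 1 p.2] at hp2
    exact hp2
  have hSpos : ∀ p ∈ S, 0 < dist 1 (p.1 * p.2) := by
    rintro ⟨a, b⟩ ⟨⟨ha, hb⟩, hab⟩
    refine dist_pos.2 fun h1 => ?_
    have e₁ := h.proj_eq_of_mul_eq ⟨a, ha⟩ ⟨b, hb⟩ h1.symm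
    have e₂ := h.proj_eq_of_mul_eq (g := 1) 1 1 (by simp)
    have ha1 : a = 1 := congrArg Subtype.val (e₁.1.symm.trans e₂.1)
    have hb1 : b = 1 := congrArg Subtype.val (e₁.2.symm.trans e₂.2)
    simp only [ha1, hb1, dist_self, max_self] at hab
    exact hr.ne hab
  obtain ⟨c, hc, hcS⟩ : ∃ c : ℝ, 0 < c ∧ ∀ p ∈ S, c ≤ dist 1 (p.1 * p.2) :=
    hS.exists_forall_le' (by fun_prop) hSpos
  refine ⟨r / c, (div_pos hr hc).le, fun g => ?_⟩
  set a := h.projLeft g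
  set b := h.projRight g
  set m := max (dist (1 : G) a) (dist (1 : G) b) with hm
  rcases (le_max_of_le_left dist_nonneg : 0 ≤ m).eq_or_lt with h0 | hmpos
  · rw [hm, ← h0]
    positivity
  have ht : 0 < r / m := div_pos hr hmpos
  have hmem : (δ (r / m) a, δ (r / m) b) ∈ S := by
    refine ⟨⟨hδN _ ht _ a.2, hδH _ ht _ b.2⟩, ?_⟩
    simp only [hδ1 _ ht, ← mul_max_of_nonneg _ _ ht.le, ← hm]
    exact div_mul_cancel₀ r hmpos.ne'
  have hle := hcS _ hmem
  simp only [← map_mul] at hle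
  rw [h.projLeft_mul_projRight g, hδ1 _ ht, div_mul_eq_mul_div, le_div_iff₀ hmpos] at hle
  rw [div_mul_eq_mul_div, le_div_iff₀ hc]
  linarith

end LeftInvariant

theorem mainTheorem4 {G : Type*} [Group G] [MetricSpace G] [IsTopologicalGroup G]
    (hleft : ∀ a x y : G, dist (a * x) (a * y) = dist x y)
    (N H : Subgroup G) (hN : N.Normal) (hsplit : IsSplitting N H) :
    (∀ (n : ℕ) [ChartedSpace (EuclideanSpace ℝ (Fin n)) G] [LieGroup (𝓡 n) ∞ G]
        [SimplyConnectedSpace G] (S : Stratification n G),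
        S.IsHomogeneousDist → S.IsHomogeneousSubgroup N → S.IsHomogeneousSubgroup H →
          IsLipschitzHom hsplit.projRight ∧ IsLipschitzAtOne hsplit.projLeft) ∧
    (IsLipschitzHom hsplit.projRight ∨ IsLipschitzAtOne hsplit.projLeft →
      (∀ g : G, IsIntrinsicLipschitzGraph (QuotientGroup.mk : G → G ⧸ H)
        ((fun x : G => g * x) '' (N : Set G))) ∧
      (∀ ψ : N → H, IsFSSCLipschitz hsplit ψ →
        ∃ φ : G ⧸ H → G,
          (∀ g : G, φ (QuotientGroup.mk g) =
            (hsplit.projLeft g : G) * (ψ (hsplit.projLeft g) : G)) ∧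
          IsIntrinsicLipschitzSection (QuotientGroup.mk : G → G ⧸ H) φ ∧
          Set.range φ = groupGraph ψ) ∧
      (∀ φ : G ⧸ H → G, IsIntrinsicLipschitzSection (QuotientGroup.mk : G → G ⧸ H) φ →
        ∃ ψ : N → H,
          (∀ n : N, (ψ n : G) = (n : G)⁻¹ * φ (QuotientGroup.mk (n : G))) ∧
          IsFSSCLipschitz hsplit ψ ∧
          Set.range φ = groupGraph ψ)) := by
  refine ⟨fun n _ _ _ S hS hSN hSH => ?_, fun hRL => ?_⟩
  · have : LocallyCompactSpace G := ChartedSpace.locallyCompactSpace (EuclideanSpace ℝ (Fin n)) G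
    obtain ⟨K, hK, hbound⟩ := hsplit.exists_max_dist_le_mul_dist S.dilation hS hSN hSH
    exact ⟨hsplit.isLipschitzHom_projRight hleft hN hK
      fun g => (le_max_right _ _).trans (hbound g),
      K, fun g => (le_max_left _ _).trans (hbound g)⟩
  · have hL := hsplit.isLipschitzAtOne_projLeft hleft hRL
    refine ⟨fun g => IsIntrinsicLipschitzGraph.mul_left_image hleft ?_ g,
      fun ψ hψ => hψ.exists_section hleft hL,
      fun φ hφ => hφ.exists_isFSSCLipschitz hleft hsplit⟩
    obtain ⟨φ, -, hφ, hrange⟩ := (isFSSCLipschitz_one hsplit).exists_section hleft hL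
    exact ⟨φ, hφ, hrange.trans (by simp [groupGraph])⟩
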